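/- Let $p$ and $q$ be distinct odd primes. Let $m$ be the smallest positive integer such that $p$ divides $|\mathrm{Sp}(2m,q)|$, and let $n$ be the smallest positive integer such that $q$ divides $|\mathrm{Sp}(2n,p)|$. Let $A = Q \rtimes K$ be a semidirect product of an extra-special $q$-group $Q$ of order $q^{2m+1}$ and exponent $q$ with a cyclic group $K$ of order $p$ which acts trivially on $Z(Q)$ and faithfully on $Q/Z(Q)$. Let $B = P \rtimes L$ be a semidirect product of an extra-special $p$-group $P$ of order $p^{2n+1}$ and exponent $p$ with a cyclic group $L$ of order $q$ which acts trivially on $Z(P)$ and faithfully on $P/Z(P)$. Let $C$ be a cyclic group of order $pq$ which is identified, by injective homomorphisms $C \to A$ and $C \to B$, with a Carter subgroup (a nilpotent self-normalizing subgroup) of $A$ and with a Carter subgroup of $B$, and let $X = A *_C B$ be the resulting free product with amalgamation. Then: 1. $X$ is torsion simple, that is, every proper non-trivial normal subgroup of $X$ is torsion free; moreover, every proper normal subgroup of $X$ is a free group (the trivial group being free of rank $0$). 2. $X$ is perfect, that is, $X = [X,X]$. 3. $X$ has a free normal subgroup of finite index. 4. $X$ has a non-abelian finite simple group as a quotient.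 -/

import Mathlib

universe u v

/-- `G` is an extra-special `p`-group: a finite `p`-group whose centre has order `p` and coincides
with the derived subgroup, and whose central quotient is elementary abelian
(abelian since `[G, G] = Z(G)`, of exponent dividing `p` since `x ^ p ∈ Z(G)`). -/
structure IsExtraspecial (p : ℕ) (G : Type u) [Group G] : Prop where
  finite : Finite G
  isPGroup : IsPGroup p G
  card_center : Nat.card (Subgroup.center G) = p
  commutator_eq_center : commutator G = Subgroup.center G
  pow_mem_center : ∀ x : G, x ^ p ∈ Subgroup.center G

/-- A Carter subgroup: a nilpotent self-normalizing subgroup. -/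
def IsCarterSubgroup {G : Type u} [Group G] (H : Subgroup G) : Prop :=
  Group.IsNilpotent H ∧ Subgroup.normalizer (H : Set G) = H

/-- The order of the finite symplectic group `Sp(2k, r)`, for a prime `r`. -/
noncomputable def symplecticOrder (k r : ℕ) : ℕ :=
  Nat.card (Matrix.symplecticGroup (Fin k) (ZMod r))

/-- `m` is the smallest positive integer such that `p` divides `|Sp(2m, q)|`. -/
def IsMinimalSymplecticRank (p q m : ℕ) : Prop :=
  IsLeast {k : ℕ | 0 < k ∧ p ∣ symplecticOrder k q} m

/-- The action `φ` of `K` on `Q` is trivial on `Z(Q)`. -/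
def ActsTriviallyOnCenter {Q K : Type u} [Group Q] [Group K] (φ : K →* MulAut Q) : Prop :=
  ∀ k : K, ∀ z ∈ Subgroup.center Q, φ k z = z

/-- The action of `K` on `Q / Z(Q)` induced by `φ` is faithful. -/
def ActsFaithfullyOnCentralQuotient {Q K : Type u} [Group Q] [Group K]
    (φ : K →* MulAut Q) : Prop :=
  ∀ k : K, (∀ x : Q, (QuotientGroup.mk (φ k x) : Q ⧸ Subgroup.center Q) = QuotientGroup.mk x) →
    k = 1

/-- The two-member family of groups `A`, `B`. -/
def AmalgamFactor (A B : Type u) : Bool → Type u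
  | false => A
  | true => B

instance AmalgamFactor.instGroup (A B : Type u) [Group A] [Group B] :
    ∀ i, Group (AmalgamFactor A B i)
  | false => inferInstanceAs (Group A)
  | true => inferInstanceAs (Group B)

/-- The two-member family of homomorphisms `α : C → A`, `β : C → B`. -/
def amalgamMap {A B : Type u} {C : Type v} [Group A] [Group B] [Group C]
    (α : C →* A) (β : C →* B) : ∀ i, C →* AmalgamFactor A B i
  | false => α
  | true => β

/-- The amalgam `A *_C B` along `α : C → A` and `β : C → B`: the pushout in the category of
groups. -/
abbrev Amalgam {A B : Type u} {C : Type v} [Group A] [Group B] [Group C]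
    (α : C →* A) (β : C →* B) : Type (max u v) :=
  Monoid.PushoutI (amalgamMap α β)

/-- A subgroup is torsion free if it has no nontrivial element of finite order. -/
def IsTorsionFreeSubgroup {G : Type u} [Group G] (N : Subgroup G) : Prop :=
  ∀ x ∈ N, IsOfFinOrder x → x = 1

/-- A group is torsion simple if all its proper nontrivial normal subgroups are torsion free. -/
def IsTorsionSimple (G : Type u) [Group G] : Prop :=
  ∀ N : Subgroup G, N.Normal → N ≠ ⊥ → N ≠ ⊤ → IsTorsionFreeSubgroup N

/-!
Write `A = Q ⋊ K`, `B = P ⋊ L` and `X` for the amalgam. Everything follows from two facts.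

* A proper normal subgroup `N` of `X` meets `A` and `B` trivially (`comap_of_eq_bot_of_ne_top`).
  As `C` is self-normalizing it contains `Z(Q)` and `Z(P)`, which are therefore its subgroups of
  order `q` and `p`. A nontrivial normal subgroup of `A` contains `Z(Q)`
  (`map_inl_center_le_of_normal`). An element of order `p` of `C` acts without fixed points on
  `Q / Z(Q)`, since the lift of a fixed point would normalize `C`, so it generates `A` as a normal
  subgroup (`eq_top_of_apply_mem`). The same holds for `B` with `p` and `q` exchanged. If `N` meets
  `A` nontrivially, it contains the elements of order `q` of `C`, hence `B`, hence the elements of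
  order `p` of `C`, hence `A`.

* A normal subgroup `N` of an amalgam that meets the factors trivially is free
  (`Monoid.PushoutI.isFreeGroup_of_comap_of_eq_bot`). It acts freely on the Bass–Serre tree, and
  the fundamental group of the quotient graph embeds into the free group on the edges of that graph
  by reading off the edges of a path. This can be done without trees: the edges are cosets of
  `N ⊔ C`, the edge word of a path is a cocycle on `X` defined on each factor, and a reduced word of
  `X` has a reduced edge word because letters outside `C` stay outside `N ⊔ C`. The theorem of
  Nielsen and Schreier then applies.

Hence proper normal subgroups are free, in particular torsion free. The commutator subgroup meets
`Q` nontrivially, so `X` is perfect. Finally `A` and `B` both act on `A / C × B / C × C` as a union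
of regular orbits with the same action of `C`, which gives a nontrivial finite quotient of `X`
(`exists_normal_finiteIndex_ne_top`). Its kernel is a free normal subgroup of finite index. A
proper normal subgroup of minimal finite index has a simple quotient, which is nonabelian because
`X` is perfect.
-/

open scoped commutatorElement

/-! ### Normal subgroups of an amalgam that meet the factors trivially -/

namespace Monoid.PushoutI

open CoprodI

variable {ι : Type*} {G : ι → Type*} {H : Type*} [∀ i, Group (G i)] [Group H]
  {φ : ∀ i, H →* G i}

/-- The generator attached to the edge of the quotient graph through `x` of type `i`. The edges of
type `i` are indexed by the cosets of `N ⊔ H`; inverting `x` turns the left cosets of Mathlib's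
quotient into right cosets, on which left multiplication by `H` is trivial. -/
def edgeLabel (N : Subgroup (PushoutI φ)) (i : ι) (x : PushoutI φ) :
    FreeGroup ((PushoutI φ ⧸ (N ⊔ (base φ).range)) × ι) :=
  FreeGroup.of ((x⁻¹ : PushoutI φ), i)

theorem edgeLabel_base_mul (N : Subgroup (PushoutI φ)) (i : ι) (h : H) (x : PushoutI φ) :
    edgeLabel N i (base φ h * x) = edgeLabel N i x := by
  have : (((base φ h * x)⁻¹ : PushoutI φ) : PushoutI φ ⧸ (N ⊔ (base φ).range)) =
      ((x⁻¹ : PushoutI φ) : PushoutI φ ⧸ (N ⊔ (base φ).range)) := by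
    rw [QuotientGroup.eq]
    apply Subgroup.mem_sup_right
    exact ⟨h, by group⟩
  simp only [edgeLabel]
  rw [this]

theorem edgeLabel_mul_mem (N : Subgroup (PushoutI φ)) [hN : N.Normal] (i : ι)
    (x : PushoutI φ) {y : PushoutI φ} (hy : y ∈ N) :
    edgeLabel N i (x * y) = edgeLabel N i x := by
  have : (((x * y)⁻¹ : PushoutI φ) : PushoutI φ ⧸ (N ⊔ (base φ).range)) =
      ((x⁻¹ : PushoutI φ) : PushoutI φ ⧸ (N ⊔ (base φ).range)) := by
    rw [QuotientGroup.eq]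
    apply Subgroup.mem_sup_left
    simpa using hN.conj_mem y hy x
  simp only [edgeLabel]
  rw [this]

/-- A factor element `a` of type `i` acts on pairs (label, position): it moves `x` to `a * x` and
multiplies the label by the edge entering `a * x` and the inverse of the edge leaving `x`, both of
type `i`. -/
def factorLabelAction (N : Subgroup (PushoutI φ)) (i : ι) :
    G i →* Function.End (FreeGroup ((PushoutI φ ⧸ (N ⊔ (base φ).range)) × ι) × PushoutI φ) where
  toFun a := fun z => (edgeLabel N i (of i a * z.2) * (edgeLabel N i z.2)⁻¹ * z.1, of i a * z.2)
  map_one' := by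
    funext z
    change _ = z
    simp
  map_mul' a b := by
    funext z
    change _ = (edgeLabel N i (of i a * (of i b * z.2)) * (edgeLabel N i (of i b * z.2))⁻¹ *
      (edgeLabel N i (of i b * z.2) * (edgeLabel N i z.2)⁻¹ * z.1), of i a * (of i b * z.2))
    simp [mul_assoc]

/-- The action of the amalgamated subgroup on pairs (label, position): it keeps the label. -/
def baseLabelAction (N : Subgroup (PushoutI φ)) :
    H →* Function.End (FreeGroup ((PushoutI φ ⧸ (N ⊔ (base φ).range)) × ι) × PushoutI φ) where
  toFun h := fun z => (z.1, base φ h * z.2)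
  map_one' := by
    funext z
    change _ = z
    simp
  map_mul' a b := by
    funext z
    change _ = (z.1, base φ a * (base φ b * z.2))
    simp [mul_assoc]

/-- The action of the amalgam on pairs (label, position). -/
def labelAction (N : Subgroup (PushoutI φ)) :
    PushoutI φ →* Function.End
      (FreeGroup ((PushoutI φ ⧸ (N ⊔ (base φ).range)) × ι) × PushoutI φ) :=
  lift (factorLabelAction N) (baseLabelAction N) fun i => by
    ext1 h
    funext z
    change (edgeLabel N i (of i (φ i h) * z.2) * (edgeLabel N i z.2)⁻¹ * z.1,
      of i (φ i h) * z.2) = (z.1, base φ h * z.2)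
    simp [of_apply_eq_base, edgeLabel_base_mul]

theorem labelAction_of (N : Subgroup (PushoutI φ)) (i : ι) (a : G i)
    (z : FreeGroup ((PushoutI φ ⧸ (N ⊔ (base φ).range)) × ι) × PushoutI φ) :
    labelAction N (of i a) z =
      (edgeLabel N i (of i a * z.2) * (edgeLabel N i z.2)⁻¹ * z.1, of i a * z.2) := by
  have : labelAction N (of i a) = factorLabelAction N i a := lift_of ..
  rw [this]
  rfl

theorem labelAction_base (N : Subgroup (PushoutI φ)) (h : H)
    (z : FreeGroup ((PushoutI φ ⧸ (N ⊔ (base φ).range)) × ι) × PushoutI φ) :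
    labelAction N (base φ h) z = (z.1, base φ h * z.2) := by
  have : labelAction N (base φ h) = baseLabelAction N h := lift_base ..
  rw [this]
  rfl

theorem labelAction_mul (N : Subgroup (PushoutI φ)) (x y : PushoutI φ)
    (z : FreeGroup ((PushoutI φ ⧸ (N ⊔ (base φ).range)) × ι) × PushoutI φ) :
    labelAction N (x * y) z = labelAction N x (labelAction N y z) :=
  congrFun (map_mul (labelAction N) x y) z

/-- The label in the free group on the edges of the path from `g` to `x * g`. -/
def label (N : Subgroup (PushoutI φ)) (x g : PushoutI φ) :
    FreeGroup ((PushoutI φ ⧸ (N ⊔ (base φ).range)) × ι) :=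
  (labelAction N x (1, g)).1

theorem labelAction_apply (N : Subgroup (PushoutI φ)) (x : PushoutI φ)
    (z : FreeGroup ((PushoutI φ ⧸ (N ⊔ (base φ).range)) × ι) × PushoutI φ) :
    labelAction N x z = (label N x z.2 * z.1, x * z.2) := by
  induction x using PushoutI.induction_on generalizing z with
  | of i g => simp [label, labelAction_of]
  | base h => simp [label, labelAction_base]
  | mul x y hx hy =>
    rw [label, labelAction_mul, labelAction_mul, hy z, hy (1, z.2), hx, hx]
    simp [mul_assoc]

theorem label_of (N : Subgroup (PushoutI φ)) (i : ι) (a : G i) (g : PushoutI φ) :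
    label N (of i a) g = edgeLabel N i (of i a * g) * (edgeLabel N i g)⁻¹ := by
  simp [label, labelAction_of]

theorem label_base (N : Subgroup (PushoutI φ)) (h : H) (g : PushoutI φ) :
    label N (base φ h) g = 1 := by
  simp [label, labelAction_base]

theorem label_mul (N : Subgroup (PushoutI φ)) (x y g : PushoutI φ) :
    label N (x * y) g = label N x (y * g) * label N y g := by
  rw [label, labelAction_mul, labelAction_apply N y, labelAction_apply N x]
  simp

theorem label_mul_mem (N : Subgroup (PushoutI φ)) [N.Normal] (x g : PushoutI φ)
    {y : PushoutI φ} (hy : y ∈ N) : label N x (g * y) = label N x g := by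
  induction x using PushoutI.induction_on generalizing g with
  | of i a => rw [label_of, label_of, ← mul_assoc, edgeLabel_mul_mem N i _ hy,
      edgeLabel_mul_mem N i _ hy]
  | base h => rw [label_base, label_base]
  | mul x z hx hz => rw [label_mul, label_mul, ← mul_assoc, hx, hz]

/-- On `N` the label of a path from the base point depends multiplicatively on its end point,
because labels are invariant under translation by `N`. -/
def labelHom (N : Subgroup (PushoutI φ)) [N.Normal] :
    N →* FreeGroup ((PushoutI φ ⧸ (N ⊔ (base φ).range)) × ι) :=
  MonoidHom.mk' (fun x => label N x 1) fun x y => by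
    have := label_mul_mem N x 1 y.2
    rw [one_mul] at this
    rw [Subgroup.coe_mul, label_mul, mul_one, this]

/-- The product in the amalgam of a list of letters. -/
def listProd (φ : ∀ i, H →* G i) (l : List (Σ i, G i)) : PushoutI φ :=
  (l.map fun s => (of s.1 s.2 : PushoutI φ)).prod

/-- The list of signed edges read along the path of a list of letters. -/
def labelList (N : Subgroup (PushoutI φ)) :
    List (Σ i, G i) → List (((PushoutI φ ⧸ (N ⊔ (base φ).range)) × ι) × Bool)
  | [] => []
  | s :: l =>
    ((((of s.1 s.2 * listProd φ l)⁻¹ : PushoutI φ), s.1), true) ::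
      ((((listProd φ l)⁻¹ : PushoutI φ), s.1), false) :: labelList N l

theorem label_listProd (N : Subgroup (PushoutI φ)) (l : List (Σ i, G i)) :
    label N (listProd φ l) 1 = FreeGroup.mk (labelList N l) := by
  induction l with
  | nil => simpa [listProd, labelList, FreeGroup.one_eq_mk] using label_base N (1 : H) 1
  | cons s l ih =>
    have h : listProd φ (s :: l) = of s.1 s.2 * listProd φ l := by simp [listProd]
    rw [h, label_mul, ih, label_of, mul_one]
    simp [edgeLabel, labelList, FreeGroup.of, FreeGroup.inv_mk, FreeGroup.mul_mk, FreeGroup.invRev]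

theorem listProd_toList (w : Word G) : listProd φ w.toList = ofCoprodI w.prod := by
  simp [listProd, Word.prod, map_list_prod, Function.comp_def]

/-- A letter outside `H` moves to a different coset of `N ⊔ H` when `N` meets the factor
trivially. -/
theorem mk_of_mul_inv_ne (N : Subgroup (PushoutI φ)) [N.Normal]
    (hN : ∀ i, N.comap (of i) = ⊥)
    {i : ι} {a : G i} (ha : a ∉ (φ i).range) (x : PushoutI φ) :
    (((of i a * x)⁻¹ : PushoutI φ) : PushoutI φ ⧸ (N ⊔ (base φ).range)) ≠
      ((x⁻¹ : PushoutI φ) : PushoutI φ ⧸ (N ⊔ (base φ).range)) := by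
  intro h
  rw [QuotientGroup.eq, inv_inv, mul_assoc, mul_inv_cancel, mul_one,
    Subgroup.mem_sup_of_normal_left] at h
  obtain ⟨y, hy, _, ⟨h, rfl⟩, hyz⟩ := h
  have h1 : a * (φ i h)⁻¹ ∈ N.comap (of i) := by
    rw [Subgroup.mem_comap, map_mul, ← hyz, map_inv, of_apply_eq_base]
    simpa using hy
  rw [hN, Subgroup.mem_bot, mul_inv_eq_one] at h1
  exact ha ⟨h, h1.symm⟩

/-- The edge path of a reduced word does not backtrack. -/
theorem isReduced_labelList (N : Subgroup (PushoutI φ)) [N.Normal]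
    (hN : ∀ i, N.comap (of i) = ⊥)
    {l : List (Σ i, G i)} (hl : ∀ s ∈ l, s.2 ∉ (φ s.1).range)
    (hc : l.IsChain fun s t => s.1 ≠ t.1) : FreeGroup.IsReduced (labelList N l) := by
  induction l with
  | nil => exact FreeGroup.IsReduced.nil
  | cons s l ih =>
    rw [labelList, FreeGroup.isReduced_cons_cons]
    constructor
    · intro h
      exact absurd (congrArg Prod.fst h)
        (mk_of_mul_inv_ne N hN (hl s List.mem_cons_self) _)
    · have ih := ih (fun t ht => hl t (List.mem_cons_of_mem _ ht)) hc.tail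
      cases l with
      | nil => exact FreeGroup.IsReduced.singleton
      | cons t l =>
        rw [labelList, FreeGroup.isReduced_cons_cons]
        refine ⟨fun h => absurd (congrArg Prod.snd h) ?_, by simpa only [labelList] using ih⟩
        rw [List.isChain_cons_cons] at hc
        exact hc.1

theorem exists_reduced_list (hφ : ∀ i, Function.Injective (φ i)) (x : PushoutI φ) :
    ∃ (h : H) (l : List (Σ i, G i)), (∀ s ∈ l, s.2 ∉ (φ s.1).range) ∧
      (l.IsChain fun s t => s.1 ≠ t.1) ∧ x = base φ h * listProd φ l := by
  classical
  obtain ⟨d⟩ := NormalWord.transversal_nonempty φ hφ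
  obtain ⟨w, rfl⟩ := (NormalWord.equiv (d := d)).symm.surjective x
  refine ⟨w.head, w.toList, ?_, w.chain_ne, by rw [listProd_toList]; rfl⟩
  rintro ⟨i, a⟩ hs ha
  apply w.ne_one _ hs
  -- `a = a * 1 = 1 * a` are two factorizations along the transversal
  have := @(d.compl i).1 (⟨a, ha⟩, ⟨1, d.one_mem i⟩) (⟨1, one_mem _⟩, ⟨a, w.normalized i a hs⟩)
    (by simp)
  simpa using (congrArg (fun z => (z.2 : G i)) this).symm

theorem labelHom_injective [Nonempty ι] (N : Subgroup (PushoutI φ)) [N.Normal]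
    (hφ : ∀ i, Function.Injective (φ i)) (hN : ∀ i, N.comap (of i) = ⊥) :
    Function.Injective (labelHom N) := by
  classical
  rw [injective_iff_map_eq_one]
  rintro ⟨x, hx⟩ h
  obtain ⟨b, l, hl, hc, rfl⟩ := exists_reduced_list hφ x
  have h1 : FreeGroup.mk (labelList N l) = 1 := by
    rw [← label_listProd]
    simpa [labelHom, label_mul, label_base] using h
  have h2 : labelList N l = [] := by
    have := (isReduced_labelList N hN hl hc).reduce_eq
    rw [← this, ← FreeGroup.toWord_mk, h1, FreeGroup.toWord_one]
  cases l with
  | cons s l => simp [labelList] at h2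
  | nil =>
    obtain ⟨i⟩ := ‹Nonempty ι›
    have hb : φ i b ∈ N.comap (of i) := by
      rw [Subgroup.mem_comap, of_apply_eq_base]
      simpa [listProd] using hx
    rw [hN, Subgroup.mem_bot] at hb
    apply Subtype.ext
    simp [listProd, ← of_apply_eq_base φ i, hb]

/-- A normal subgroup of an amalgam acts freely on the Bass–Serre tree if it meets the factors
trivially, and is then free. -/
theorem isFreeGroup_of_comap_of_eq_bot [Nonempty ι] (N : Subgroup (PushoutI φ)) [N.Normal]
    (hφ : ∀ i, Function.Injective (φ i)) (hN : ∀ i, N.comap (of i) = ⊥) : IsFreeGroup N :=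
  IsFreeGroup.ofMulEquiv (MonoidHom.ofInjective (labelHom_injective N hφ hN)).symm

end Monoid.PushoutI

theorem IsFreeGroup.isMulTorsionFree (G : Type*) [Group G] [IsFreeGroup G] : IsMulTorsionFree G :=
  Function.Injective.isMulTorsionFree (IsFreeGroup.toFreeGroup G).toMonoidHom
    (IsFreeGroup.toFreeGroup G).injective

/-! ### Normal subgroups of the factors -/

theorem IsExtraspecial.center_le_of_normal {q : ℕ} (hq : q.Prime) {Q : Type*} [Group Q]
    (hQ : IsExtraspecial q Q) {M : Subgroup Q} (hM : M.Normal) (hM1 : M ≠ ⊥) :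
    Subgroup.center Q ≤ M := by
  obtain ⟨⟨x, hxM⟩, hx1⟩ := Subgroup.ne_bot_iff_exists_ne_one.1 hM1
  replace hx1 : x ≠ 1 := fun h => hx1 (Subtype.ext h)
  -- a nontrivial element of `M`, or one of its commutators, is central
  obtain ⟨z, hzM, hzZ, hz1⟩ : ∃ z ∈ M, z ∈ Subgroup.center Q ∧ z ≠ 1 := by
    by_cases hx : x ∈ Subgroup.center Q
    · exact ⟨x, hxM, hx, hx1⟩
    · rw [Subgroup.mem_center_iff] at hx
      push Not at hx
      obtain ⟨g, hg⟩ := hx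
      refine ⟨⁅g, x⁆, ?_, ?_, ?_⟩
      · rw [commutatorElement_def]
        exact mul_mem (hM.conj_mem x hxM g) (inv_mem hxM)
      · rw [← hQ.commutator_eq_center, commutator_def]
        exact Subgroup.commutator_mem_commutator (Subgroup.mem_top g) (Subgroup.mem_top x)
      · rwa [Ne, commutatorElement_eq_one_iff_mul_comm]
  have : Fact (Nat.card (Subgroup.center Q)).Prime := ⟨hQ.card_center ▸ hq⟩
  rcases (M.subgroupOf (Subgroup.center Q)).eq_bot_or_eq_top_of_prime_card with h | h
  · exact absurd (Subgroup.subgroupOf_eq_bot.1 h).le_bot fun h => hz1 (h ⟨hzM, hzZ⟩)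
  · exact Subgroup.subgroupOf_eq_top.1 h

theorem IsExtraspecial.mk_mul_comm {q : ℕ} {Q : Type*} [Group Q] (hQ : IsExtraspecial q Q)
    (x y : Q ⧸ Subgroup.center Q) : x * y = y * x := by
  induction x using QuotientGroup.induction_on with | H a => ?_
  induction y using QuotientGroup.induction_on with | H b => ?_
  rw [← QuotientGroup.mk_mul, ← QuotientGroup.mk_mul, QuotientGroup.eq,
    ← hQ.commutator_eq_center, commutator_def]
  have := Subgroup.commutator_mem_commutator (Subgroup.mem_top b⁻¹) (Subgroup.mem_top a⁻¹)
  simpa [commutatorElement_def, mul_assoc] using this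

open SemidirectProduct

section Factor

variable {p q : ℕ} {Q K : Type u} [Group Q] [Group K] {φ : K →* MulAut Q}
  {C : Type v} [Group C] {α : C →* Q ⋊[φ] K}

theorem map_inl_center_le_center (hφ : ActsTriviallyOnCenter φ) :
    (Subgroup.center Q).map (inl : Q →* Q ⋊[φ] K) ≤ Subgroup.center (Q ⋊[φ] K) := by
  rintro _ ⟨z, hz, rfl⟩
  rw [Subgroup.mem_center_iff]
  intro g
  ext
  · simp [hφ g.right z hz, (Subgroup.mem_center_iff.1 hz g.left)]
  · simp

theorem map_inl_center_normal (hφ : ActsTriviallyOnCenter φ) :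
    ((Subgroup.center Q).map (inl : Q →* Q ⋊[φ] K)).Normal where
  conj_mem z hz g := by
    have := Subgroup.mem_center_iff.1 (map_inl_center_le_center hφ hz) g
    rwa [this, mul_inv_cancel_right]

theorem map_inl_center_le_range (hφ : ActsTriviallyOnCenter φ)
    (hα : Subgroup.normalizer (α.range : Set (Q ⋊[φ] K)) = α.range) :
    (Subgroup.center Q).map (inl : Q →* Q ⋊[φ] K) ≤ α.range := by
  refine (map_inl_center_le_center hφ).trans ?_
  rw [← hα]
  intro z hz
  rw [Subgroup.mem_normalizer_iff]
  intro h
  rw [← Subgroup.mem_center_iff.1 hz h, mul_inv_cancel_right]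

theorem card_comap_map_inl_center (hQ : IsExtraspecial q Q) (hφ : ActsTriviallyOnCenter φ)
    (hα : Function.Injective α)
    (hα' : Subgroup.normalizer (α.range : Set (Q ⋊[φ] K)) = α.range) :
    Nat.card (((Subgroup.center Q).map (inl : Q →* Q ⋊[φ] K)).comap α) = q := by
  rw [← Subgroup.card_map_of_injective hα, Subgroup.map_comap_eq_self
    (map_inl_center_le_range hφ hα'), Subgroup.card_map_of_injective inl_injective,
    hQ.card_center]

/-- The elements of order `q` of a self-normalizing cyclic subgroup lie in `Z(Q)`: the subgroup
contains `Z(Q)`, and a cyclic group has at most `q` elements with `c ^ q = 1`. -/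
theorem mem_map_inl_center_of_pow_eq_one (hq : q.Prime) (hQ : IsExtraspecial q Q)
    (hφ : ActsTriviallyOnCenter φ) [IsCyclic C] [Finite C] (hα : Function.Injective α)
    (hα' : Subgroup.normalizer (α.range : Set (Q ⋊[φ] K)) = α.range) {c : C} (hc : c ^ q = 1) :
    α c ∈ (Subgroup.center Q).map (inl : Q →* Q ⋊[φ] K) := by
  classical
  have := Fintype.ofFinite C
  have hcard := card_comap_map_inl_center hQ hφ hα hα'
  have hsub : ((((Subgroup.center Q).map (inl : Q →* Q ⋊[φ] K)).comap α : Subgroup C) : Set C) ⊆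
      ((Finset.univ.filter fun c : C => c ^ q = 1 : Finset C) : Set C) := by
    intro d hd
    have : d ^ Nat.card (((Subgroup.center Q).map (inl : Q →* Q ⋊[φ] K)).comap α) = 1 :=
      congrArg Subtype.val (pow_card_eq_one' (x := (⟨d, hd⟩ :
        ((Subgroup.center Q).map (inl : Q →* Q ⋊[φ] K)).comap α)))
    rw [hcard] at this
    simpa using this
  have heq := Set.eq_of_subset_of_ncard_le hsub (by
    rw [Set.ncard_coe_finset]
    exact (IsCyclic.card_pow_eq_one_le hq.pos).trans_eq hcard.symm) (Finset.finite_toSet _)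
  have : c ∈ ((Finset.univ.filter fun c : C => c ^ q = 1 : Finset C) : Set C) := by simpa using hc
  rwa [← heq] at this

/-- A nontrivial normal subgroup of the factor contains `Z(Q)`: it meets `Q` nontrivially, since an
element commuting with `Q` acts trivially on `Q / Z(Q)` and hence lies in `Q`. -/
theorem map_inl_center_le_of_normal (hq : q.Prime) (hQ : IsExtraspecial q Q)
    (hφ : ActsFaithfullyOnCentralQuotient φ) {M : Subgroup (Q ⋊[φ] K)} (hM : M.Normal)
    (hM1 : M ≠ ⊥) : (Subgroup.center Q).map (inl : Q →* Q ⋊[φ] K) ≤ M := by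
  rw [Subgroup.map_le_iff_le_comap]
  refine hQ.center_le_of_normal hq (hM.comap _) fun hbot => hM1 ?_
  have hinl : ∀ r : Q, (inl r : Q ⋊[φ] K) ∈ M → r = 1 := fun r hr => by
    rw [← Subgroup.mem_bot, ← hbot]
    exact hr
  rw [Subgroup.eq_bot_iff_forall]
  intro x hx
  have hcomm : ∀ s : Q, x * inl s = inl s * x := fun s => by
    have h1 : x * inl s * x⁻¹ * (inl s)⁻¹ = inl (x.left * φ x.right s * x.left⁻¹ * s⁻¹) := by
      ext <;> simp
    have h2 : x * inl s * x⁻¹ * (inl s)⁻¹ ∈ M := by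
      rw [mul_assoc, mul_assoc]
      refine mul_mem hx ?_
      rw [← mul_assoc]
      exact hM.conj_mem _ (inv_mem hx) _
    rw [h1] at h2
    rw [hinl (x.left * φ x.right s * x.left⁻¹ * s⁻¹) h2, map_one] at h1
    rwa [mul_inv_eq_one, mul_inv_eq_iff_eq_mul] at h1
  have hright : x.right = 1 := by
    refine hφ _ fun s => ?_
    have h := congrArg SemidirectProduct.left (hcomm s)
    simp only [mul_left, left_inl, right_inl, map_one, MulAut.one_apply] at h
    have h' := congrArg (QuotientGroup.mk : Q → Q ⧸ Subgroup.center Q) h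
    rw [QuotientGroup.mk_mul, QuotientGroup.mk_mul, hQ.mk_mul_comm] at h'
    exact mul_right_cancel h'
  have hx' : x = inl x.left := by
    ext <;> simp [hright]
  have hl : x.left = 1 := hinl _ (by rwa [← hx'])
  rw [hx', hl, map_one]

theorem apply_mem_of_normal (hq : q.Prime) (hQ : IsExtraspecial q Q)
    (hφ : ActsTriviallyOnCenter φ) (hφ' : ActsFaithfullyOnCentralQuotient φ)
    [IsCyclic C] [Finite C] (hα : Function.Injective α)
    (hα' : Subgroup.normalizer (α.range : Set (Q ⋊[φ] K)) = α.range)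
    {M : Subgroup (Q ⋊[φ] K)} (hM : M.Normal) (hM1 : M ≠ ⊥) {c : C} (hc : c ^ q = 1) :
    α c ∈ M :=
  map_inl_center_le_of_normal hq hQ hφ' hM hM1
    (mem_map_inl_center_of_pow_eq_one hq hQ hφ hα hα' hc)

theorem apply_right_ne_one (hpq : Nat.Coprime p q) (hQexp : ∀ r : Q, r ^ q = 1)
    (hα : Function.Injective α) {c : C} (hc : c ^ p = 1) (hc1 : c ≠ 1) : (α c).right ≠ 1 := by
  intro h
  have hy : α c = inl (α c).left := by ext <;> simp [h]
  have hcq : c ^ q = 1 := hα (by rw [map_pow, hy, ← map_pow, hQexp, map_one, map_one])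
  have := Nat.dvd_gcd (orderOf_dvd_of_pow_eq_one hc) (orderOf_dvd_of_pow_eq_one hcq)
  rw [hpq.gcd_eq_one, Nat.dvd_one, orderOf_eq_one_iff] at this
  exact hc1 this

/-- An element of order `p` of the self-normalizing cyclic subgroup acts without fixed points on
`Q / Z(Q)`: the lift of a fixed point would normalize that subgroup. -/
theorem mem_center_of_conj_mem (hp : p.Prime) (hq : q.Prime) (hpq : Nat.Coprime p q)
    (hQ : IsExtraspecial q Q) (hQexp : ∀ r : Q, r ^ q = 1) (hφ : ActsTriviallyOnCenter φ)
    [IsCyclic C] [Finite C] (hC : Nat.card C = p * q) (hα : Function.Injective α)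
    (hα' : Subgroup.normalizer (α.range : Set (Q ⋊[φ] K)) = α.range)
    {c : C} (hc : c ^ p = 1) (hc1 : c ≠ 1) {r : Q}
    (hr : α c * inl r * (α c)⁻¹ * (inl r)⁻¹ ∈ (Subgroup.center Q).map (inl : Q →* Q ⋊[φ] K)) :
    r ∈ Subgroup.center Q := by
  have hZn := map_inl_center_normal hφ
  have hZr := map_inl_center_le_range hφ hα'
  have hZc := card_comap_map_inl_center hQ hφ hα hα'
  have hZsub := map_inl_center_le_center hφ
  have hZcen := fun {c : C} => mem_map_inl_center_of_pow_eq_one (c := c) hq hQ hφ hα hα'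
  generalize hZ : (Subgroup.center Q).map (inl : Q →* Q ⋊[φ] K) = Z at *
  -- the elements of `C` that commute with `r` modulo `Z(Q)`
  let D : Subgroup C := (Subgroup.centralizer {(QuotientGroup.mk' Z (inl r))}).comap
    ((QuotientGroup.mk' Z).comp α)
  have hD : ∀ d : C, d ∈ D ↔ α d * inl r * (α d)⁻¹ * (inl r)⁻¹ ∈ Z := fun d => by
    rw [← QuotientGroup.eq_one_iff (N := Z), Subgroup.mem_comap,
      Subgroup.mem_centralizer_singleton_iff]
    simp only [QuotientGroup.mk_mul, QuotientGroup.mk_inv, MonoidHom.comp_apply,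
      QuotientGroup.mk'_apply]
    rw [mul_inv_eq_one, mul_inv_eq_iff_eq_mul]
  have hcD : c ∈ D := (hD c).2 hr
  have hpD : p ∣ Nat.card D := by
    have := Fact.mk hp
    rw [← orderOf_eq_prime hc hc1]
    exact Subgroup.orderOf_dvd_natCard D hcD
  have hqD : q ∣ Nat.card D := by
    have hle : Z.comap α ≤ D := fun d hd => (hD d).2 (by
      rw [← Subgroup.mem_center_iff.1 (hZsub hd), mul_inv_cancel_right, mul_inv_cancel]
      exact one_mem _)
    rw [← hZc]
    exact Subgroup.card_dvd_of_le hle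
  have hDtop : D = ⊤ := by
    apply Subgroup.eq_top_of_le_card
    rw [hC]
    exact Nat.le_of_dvd Nat.card_pos (hpq.mul_dvd_of_dvd_of_dvd hpD hqD)
  have hrn : (inl r : Q ⋊[φ] K) ∈ α.range := by
    rw [← hα']
    have : Finite (α.range : Set (Q ⋊[φ] K)) := (Set.finite_range α).to_subtype
    apply Subgroup.mem_normalizer_fintype
    rintro _ ⟨d, rfl⟩
    have h1 := inv_mem ((hD d).1 (hDtop ▸ Subgroup.mem_top d))
    have h2 := mul_mem (hZr h1) ⟨d, rfl⟩
    have h3 : inl r * α d * (inl r)⁻¹ = (α d * inl r * (α d)⁻¹ * (inl r)⁻¹)⁻¹ * α d := by group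
    rw [h3]
    exact h2
  obtain ⟨d, hd⟩ := hrn
  have hdq : d ^ q = 1 := hα (by rw [map_pow, hd, ← map_pow, hQexp, map_one, map_one])
  have := hZcen hdq
  rw [hd, ← hZ] at this
  obtain ⟨z, hz, hzr⟩ := this
  rwa [← inl_injective hzr]

/-- A normal subgroup containing an element of order `p` of the self-normalizing cyclic subgroup is
the whole factor. As that element acts on `Q / Z(Q)` without fixed points, the commutators with it
cover `Q / Z(Q)`. -/
theorem eq_top_of_apply_mem (hp : p.Prime) (hq : q.Prime) (hpq : Nat.Coprime p q)
    (hQ : IsExtraspecial q Q) (hQexp : ∀ r : Q, r ^ q = 1) (hK : Nat.card K = p)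
    (hφ : ActsTriviallyOnCenter φ) (hφ' : ActsFaithfullyOnCentralQuotient φ)
    [IsCyclic C] [Finite C] (hC : Nat.card C = p * q) (hα : Function.Injective α)
    (hα' : Subgroup.normalizer (α.range : Set (Q ⋊[φ] K)) = α.range)
    {M : Subgroup (Q ⋊[φ] K)} (hM : M.Normal) {c : C} (hc : c ^ p = 1) (hc1 : c ≠ 1)
    (hcM : α c ∈ M) : M = ⊤ := by
  have := hQ.finite
  have hfix := fun {r : Q} =>
    mem_center_of_conj_mem (r := r) hp hq hpq hQ hQexp hφ hC hα hα' hc hc1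
  have hyr : (α c).right ≠ 1 := apply_right_ne_one hpq hQexp hα hc hc1
  have hy1 : α c ≠ 1 := fun h => hyr (by rw [h, one_right])
  have hZM := map_inl_center_le_of_normal hq hQ hφ' hM fun h => hy1 (by
    rwa [h, Subgroup.mem_bot] at hcM)
  generalize α c = y at *
  have hconj : ∀ r : Q, y * inl r * y⁻¹ * (inl r)⁻¹ =
      inl (y.left * φ y.right r * y.left⁻¹ * r⁻¹) := fun r => by ext <;> simp
  -- `r ↦ [y, r]`, a homomorphism modulo `Z(Q)`
  let f : Q →* Q ⧸ Subgroup.center Q := MonoidHom.mk'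
    (fun r => ((y.left * φ y.right r * y.left⁻¹ * r⁻¹ : Q) : Q ⧸ Subgroup.center Q)) fun r s => by
      have h : y.left * φ y.right (r * s) * y.left⁻¹ * (r * s)⁻¹ =
          (y.left * φ y.right r * y.left⁻¹) * (y.left * φ y.right s * y.left⁻¹ * s⁻¹) * r⁻¹ := by
        rw [map_mul]
        group
      rw [h, QuotientGroup.mk_mul, QuotientGroup.mk_mul, mul_assoc,
        hQ.mk_mul_comm (QuotientGroup.mk (y.left * φ y.right s * y.left⁻¹ * s⁻¹)), ← mul_assoc,
        ← QuotientGroup.mk_mul]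
  have hker : f.ker = Subgroup.center Q := by
    ext r
    rw [MonoidHom.mem_ker]
    have hf : f r = 1 ↔ y.left * φ y.right r * y.left⁻¹ * r⁻¹ ∈ Subgroup.center Q :=
      QuotientGroup.eq_one_iff _
    rw [hf]
    refine ⟨fun h => hfix ?_, fun h => ?_⟩
    · rw [hconj]
      exact Subgroup.mem_map_of_mem _ h
    · rw [hφ _ r h, Subgroup.mem_center_iff.1 h, mul_inv_cancel_right, mul_inv_cancel]
      exact one_mem _
  have hrange : f.range = ⊤ := by
    apply Subgroup.eq_top_of_card_eq
    rw [← Nat.card_congr (QuotientGroup.quotientKerEquivRange f).toEquiv, hker]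
  have hinl : ∀ r : Q, (inl r : Q ⋊[φ] K) ∈ M := fun r => by
    obtain ⟨s, hs⟩ := MonoidHom.range_eq_top.1 hrange (r : Q ⧸ Subgroup.center Q)
    have hs' := hZM (Subgroup.mem_map_of_mem inl (QuotientGroup.eq.1 hs))
    rw [map_mul, map_inv, ← hconj] at hs'
    refine (Subgroup.mul_mem_cancel_left M (inv_mem ?_)).1 hs'
    rw [mul_assoc, mul_assoc]
    refine mul_mem hcM ?_
    rw [← mul_assoc]
    exact hM.conj_mem _ (inv_mem hcM) _
  rw [Subgroup.eq_top_iff']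
  intro a
  have := Fact.mk hp
  obtain ⟨i, hi⟩ := Subgroup.mem_zpowers_iff.1 (mem_zpowers_of_prime_card hK hyr (g' := a.right))
  have ha : a = inl (a * (y ^ i)⁻¹).left * y ^ i := by
    have h : (a * (y ^ i)⁻¹).right = 1 := by
      have h2 : (y ^ i).right = y.right ^ i := map_zpow (rightHom : Q ⋊[φ] K →* K) y i
      rw [mul_right, inv_right, h2, hi, mul_inv_cancel]
    have h3 : inl (a * (y ^ i)⁻¹).left = a * (y ^ i)⁻¹ := by ext <;> simp [h]
    rw [h3, inv_mul_cancel_right]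
  rw [ha]
  exact mul_mem (hinl _) (zpow_mem hcM i)

end Factor

/-! ### Finite quotients of an amalgam of finite groups -/

section FiniteQuotient

variable {A B : Type u} {C : Type v} [Group A] [Group B] [Group C]

/-- The action of `A` by right translation on the first component of `A × Y`, transported to `Ω`. -/
def translationHom {Y Ω : Type*} (e : Ω ≃ A × Y) : A →* Equiv.Perm Ω :=
  MonoidHom.mk' (fun a => e.symm.permCongr ((Equiv.mulRight a⁻¹).prodCongr (Equiv.refl Y)))
    fun a b => by
      ext x : 1
      simp [Equiv.permCongr_apply, Prod.map, mul_assoc]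

theorem translationHom_injective {Y Ω : Type*} [Nonempty Y] (e : Ω ≃ A × Y) :
    Function.Injective (translationHom e) := by
  intro a b h
  obtain ⟨y⟩ := ‹Nonempty Y›
  have := congrFun (congrArg DFunLike.coe h) (e.symm (1, y))
  simpa [translationHom, Equiv.permCongr_apply] using this

/-- A group as the product of the space of left cosets of an embedded subgroup with that subgroup. -/
noncomputable def cosetProdEquiv (α : C →* A) (hα : Function.Injective α) :
    (A ⧸ α.range) × C ≃ A :=
  Equiv.ofBijective (fun z => z.1.out * α z.2) <| by
    constructor
    · rintro ⟨s, c⟩ ⟨t, d⟩ h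
      have hst : s = t := by
        have := congrArg (QuotientGroup.mk : A → A ⧸ α.range) h
        simpa [QuotientGroup.mk_mul_of_mem] using this
      subst hst
      simpa [hα.eq_iff] using h
    · intro a
      obtain ⟨c, hc⟩ : ((a : A ⧸ α.range).out)⁻¹ * a ∈ α.range := by
        rw [← QuotientGroup.eq, QuotientGroup.out_eq']
      exact ⟨(a, c), by simp [hc]⟩

theorem cosetProdEquiv_mul (α : C →* A) (hα : Function.Injective α) (s : A ⧸ α.range) (c d : C) :
    cosetProdEquiv α hα (s, c * d) = cosetProdEquiv α hα (s, c) * α d := by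
  change s.out * α (c * d) = s.out * α c * α d
  rw [map_mul, mul_assoc]

/-- The set `A / C × B / C × C` as a union of copies of the regular `A`-set. -/
noncomputable def leftRegularEquiv (α : C →* A) (β : C →* B) (hα : Function.Injective α) :
    (A ⧸ α.range) × (B ⧸ β.range) × C ≃ A × (B ⧸ β.range) where
  toFun z := (cosetProdEquiv α hα (z.1, z.2.2), z.2.1)
  invFun z := (((cosetProdEquiv α hα).symm z.1).1, z.2, ((cosetProdEquiv α hα).symm z.1).2)
  left_inv z := by simp
  right_inv z := by simp

/-- The set `A / C × B / C × C` as a union of copies of the regular `B`-set. -/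
noncomputable def rightRegularEquiv (α : C →* A) (β : C →* B) (hβ : Function.Injective β) :
    (A ⧸ α.range) × (B ⧸ β.range) × C ≃ B × (A ⧸ α.range) where
  toFun z := (cosetProdEquiv β hβ (z.2.1, z.2.2), z.1)
  invFun z := (z.2, ((cosetProdEquiv β hβ).symm z.1).1, ((cosetProdEquiv β hβ).symm z.1).2)
  left_inv z := by simp
  right_inv z := by simp

theorem translationHom_left_apply (α : C →* A) (β : C →* B) (hα : Function.Injective α) (c : C)
    (z : (A ⧸ α.range) × (B ⧸ β.range) × C) :
    translationHom (leftRegularEquiv α β hα) (α c) z = (z.1, z.2.1, z.2.2 * c⁻¹) := by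
  apply (leftRegularEquiv α β hα).injective
  simp [translationHom, Equiv.permCongr_apply, leftRegularEquiv, cosetProdEquiv_mul]

theorem translationHom_right_apply (α : C →* A) (β : C →* B) (hβ : Function.Injective β) (c : C)
    (z : (A ⧸ α.range) × (B ⧸ β.range) × C) :
    translationHom (rightRegularEquiv α β hβ) (β c) z = (z.1, z.2.1, z.2.2 * c⁻¹) := by
  apply (rightRegularEquiv α β hβ).injective
  simp [translationHom, Equiv.permCongr_apply, rightRegularEquiv, cosetProdEquiv_mul]

/-- The inclusion of the first factor. -/
def amalgamInl (α : C →* A) (β : C →* B) : A →* Amalgam α β :=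
  Monoid.PushoutI.of (φ := amalgamMap α β) false

/-- The inclusion of the second factor. -/
def amalgamInr (α : C →* A) (β : C →* B) : B →* Amalgam α β :=
  Monoid.PushoutI.of (φ := amalgamMap α β) true

theorem amalgamInl_apply_eq (α : C →* A) (β : C →* B) (c : C) :
    amalgamInl α β (α c) = amalgamInr α β (β c) :=
  (Monoid.PushoutI.of_apply_eq_base (amalgamMap α β) false c).trans
    (Monoid.PushoutI.of_apply_eq_base (amalgamMap α β) true c).symm

theorem amalgamMap_injective {α : C →* A} {β : C →* B} (hα : Function.Injective α)
    (hβ : Function.Injective β) : ∀ i, Function.Injective (amalgamMap α β i)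
  | false => hα
  | true => hβ

theorem exists_comp_amalgamInl_eq {α : C →* A} {β : C →* B} {G : Type*} [Group G] (f : A →* G) (g : B →* G)
    (h : f.comp α = g.comp β) : ∃ F : Amalgam α β →* G, F.comp (amalgamInl α β) = f := by
  let fg : ∀ i, AmalgamFactor A B i →* G
    | false => f
    | true => g
  have hfg : ∀ i, (fg i).comp (amalgamMap α β i) = f.comp α := by
    rintro (_ | _)
    · rfl
    · exact h.symm
  exact ⟨Monoid.PushoutI.lift fg (f.comp α) hfg, MonoidHom.ext fun a =>
    Monoid.PushoutI.lift_of fg (f.comp α) hfg (i := false) a⟩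

/-- An amalgam of finite groups has a nontrivial finite quotient: both factors act semiregularly on
`A / C × B / C × C`, and the two actions of the amalgamated subgroup agree. -/
theorem exists_normal_finiteIndex_ne_top [Finite A] [Finite B] [Nontrivial A] {α : C →* A}
    {β : C →* B} (hα : Function.Injective α) (hβ : Function.Injective β) :
    ∃ N : Subgroup (Amalgam α β), N.Normal ∧ N.FiniteIndex ∧ N ≠ ⊤ := by
  have : Finite C := Finite.of_injective α hα
  obtain ⟨F, hF⟩ := exists_comp_amalgamInl_eq (translationHom (leftRegularEquiv α β hα))
    (translationHom (rightRegularEquiv α β hβ))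
    (MonoidHom.ext fun c => Equiv.ext fun z => (translationHom_left_apply α β hα c z).trans
      (translationHom_right_apply α β hβ c z).symm)
  refine ⟨F.ker, inferInstance, inferInstance, fun htop => ?_⟩
  obtain ⟨a, ha⟩ := exists_ne (1 : A)
  apply ha
  apply translationHom_injective (leftRegularEquiv α β hα)
  rw [← hF, map_one, MonoidHom.comp_apply, ← MonoidHom.mem_ker, htop]
  exact Subgroup.mem_top _

/-- A normal subgroup of minimal index among the proper normal subgroups of finite index has a
simple quotient. -/
theorem exists_normal_isSimpleGroup_quotient {G : Type*} [Group G]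
    (h : ∃ N : Subgroup G, N.Normal ∧ N.FiniteIndex ∧ N ≠ ⊤) :
    ∃ (N : Subgroup G) (_ : N.Normal), N.FiniteIndex ∧ IsSimpleGroup (G ⧸ N) := by
  classical
  have hn : ∃ k, ∃ N : Subgroup G, N.Normal ∧ N.FiniteIndex ∧ N ≠ ⊤ ∧ N.index = k := by
    obtain ⟨N, h1, h2, h3⟩ := h
    exact ⟨_, N, h1, h2, h3, rfl⟩
  obtain ⟨N, hN, hfin, htop, hidx⟩ := Nat.find_spec hn
  refine ⟨N, hN, hfin, ?_⟩
  have : Nontrivial (G ⧸ N) := QuotientGroup.nontrivial_iff.2 htop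
  refine ⟨fun H hH => ?_⟩
  by_contra! hH'
  have hle : N ≤ H.comap (QuotientGroup.mk' N) := QuotientGroup.le_comap_mk' N H
  have hne : H.comap (QuotientGroup.mk' N) ≠ ⊤ := fun h => hH'.2 (by
    rw [← Subgroup.map_comap_eq_self_of_surjective (QuotientGroup.mk'_surjective N) H, h,
      ← MonoidHom.range_eq_map, MonoidHom.range_eq_top]
    exact QuotientGroup.mk'_surjective N)
  have hne' : N ≠ H.comap (QuotientGroup.mk' N) := fun h => hH'.1 (by
    rw [← Subgroup.map_comap_eq_self_of_surjective (QuotientGroup.mk'_surjective N) H, ← h,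
      QuotientGroup.map_mk'_self])
  -- a normal subgroup strictly between `N` and the group has smaller index
  refine Nat.find_min hn ?_ ⟨H.comap (QuotientGroup.mk' N), hH.comap _,
    Subgroup.finiteIndex_of_le hle, hne, rfl⟩
  rw [← hidx]
  exact Subgroup.index_strictAnti (lt_of_le_of_ne hle hne')

/-! ### Normal subgroups of the amalgam -/

/-- A proper normal subgroup of the amalgam meets both factors trivially, provided that `c` and `d`
play opposite roles in the two factors: one of them lies in every nontrivial normal subgroup, and
the other one generates the factor as a normal subgroup. -/
theorem comap_of_eq_bot_of_ne_top {α : C →* A} {β : C →* B} {c d : C}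
    (hAd : ∀ M : Subgroup A, M.Normal → M ≠ ⊥ → α d ∈ M)
    (hAc : ∀ M : Subgroup A, M.Normal → α c ∈ M → M = ⊤)
    (hBc : ∀ M : Subgroup B, M.Normal → M ≠ ⊥ → β c ∈ M)
    (hBd : ∀ M : Subgroup B, M.Normal → β d ∈ M → M = ⊤)
    {N : Subgroup (Amalgam α β)} (hN : N.Normal) (hN1 : N ≠ ⊤) (i : Bool) :
    N.comap (Monoid.PushoutI.of (φ := amalgamMap α β) i) = ⊥ := by
  have hc : α c ∈ N.comap (amalgamInl α β) ↔ β c ∈ N.comap (amalgamInr α β) := by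
    rw [Subgroup.mem_comap, Subgroup.mem_comap, amalgamInl_apply_eq]
  have hd : α d ∈ N.comap (amalgamInl α β) ↔ β d ∈ N.comap (amalgamInr α β) := by
    rw [Subgroup.mem_comap, Subgroup.mem_comap, amalgamInl_apply_eq]
  have htop : N.comap (amalgamInl α β) = ⊤ → N.comap (amalgamInr α β) = ⊤ → False :=
    fun hA hB => hN1 (by
      rw [Subgroup.eq_top_iff']
      have hmem : ∀ (i : Bool) (a : AmalgamFactor A B i),
          Monoid.PushoutI.of (φ := amalgamMap α β) i a ∈ N := by
        rintro (_ | _) a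
        · exact hA.ge (Subgroup.mem_top (G := A) a)
        · exact hB.ge (Subgroup.mem_top (G := B) a)
      intro x
      induction x using Monoid.PushoutI.induction_on with
      | of i a => exact hmem i a
      | base h =>
        rw [← Monoid.PushoutI.of_apply_eq_base _ false]
        exact hmem false _
      | mul x y hx hy => exact mul_mem hx hy)
  have hnA := hN.comap (amalgamInl α β)
  have hnB := hN.comap (amalgamInr α β)
  cases i
  · by_contra h
    have hB := hBd _ hnB (hd.1 (hAd _ hnA h))
    exact htop (hAc _ hnA (hc.2 (hB ▸ Subgroup.mem_top _))) hB
  · by_contra h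
    have hA := hAc _ hnA (hc.2 (hBc _ hnB h))
    exact htop hA (hBd _ hnB (hd.1 (hA ▸ Subgroup.mem_top _)))

end FiniteQuotient

/-! ### Torsion simplicity, perfectness and quotients of the amalgam -/

theorem mainTheorem1
    (p q m n : ℕ) (hp : p.Prime) (hq : q.Prime) (hp2 : p ≠ 2) (hq2 : q ≠ 2) (hpq : p ≠ q)
    (hm : IsMinimalSymplecticRank p q m) (hn : IsMinimalSymplecticRank q p n)
    -- the factor `A = Q ⋊ K`, with `K` cyclic of order `p`
    (Q K : Type u) [Group Q] [Group K]
    (hQ : IsExtraspecial q Q) (hQcard : Nat.card Q = q ^ (2 * m + 1))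
    (hQexp : Monoid.exponent Q = q)
    (hKcyc : IsCyclic K) (hKcard : Nat.card K = p)
    (φ : K →* MulAut Q)
    (hφ_triv : ActsTriviallyOnCenter φ) (hφ_faith : ActsFaithfullyOnCentralQuotient φ)
    -- the factor `B = P ⋊ L`, with `L` cyclic of order `q`
    (P L : Type u) [Group P] [Group L]
    (hP : IsExtraspecial p P) (hPcard : Nat.card P = p ^ (2 * n + 1))
    (hPexp : Monoid.exponent P = p)
    (hLcyc : IsCyclic L) (hLcard : Nat.card L = q)
    (ψ : L →* MulAut P)
    (hψ_triv : ActsTriviallyOnCenter ψ) (hψ_faith : ActsFaithfullyOnCentralQuotient ψ)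
    -- the common cyclic subgroup `C`, identified with a Carter subgroup of `A` and of `B`
    (C : Type v) [Group C] (hCcyc : IsCyclic C) (hCcard : Nat.card C = p * q)
    (α : C →* Q ⋊[φ] K) (hα : Function.Injective α) (hα_carter : IsCarterSubgroup α.range)
    (β : C →* P ⋊[ψ] L) (hβ : Function.Injective β) (hβ_carter : IsCarterSubgroup β.range) :
    IsTorsionSimple (Amalgam α β) ∧
    (∀ N : Subgroup (Amalgam α β), N.Normal → N ≠ ⊤ → IsFreeGroup N) ∧
    commutator (Amalgam α β) = ⊤ ∧
    (∃ N : Subgroup (Amalgam α β), N.Normal ∧ N.FiniteIndex ∧ IsFreeGroup N) ∧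
    (∃ (N : Subgroup (Amalgam α β)) (_ : N.Normal), N.FiniteIndex ∧
      IsSimpleGroup (Amalgam α β ⧸ N) ∧ ¬ ∀ x y : Amalgam α β ⧸ N, x * y = y * x) := by
  have hfinC : Finite C := Nat.finite_of_card_ne_zero
    (by rw [hCcard]; exact mul_ne_zero hp.ne_zero hq.ne_zero)
  have hfinQ := hQ.finite
  have hfinP := hP.finite
  have hfinK : Finite K := Nat.finite_of_card_ne_zero (hKcard ▸ hp.ne_zero)
  have hfinL : Finite L := Nat.finite_of_card_ne_zero (hLcard ▸ hq.ne_zero)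
  have hfinA : Finite (Q ⋊[φ] K) := Finite.of_equiv _ SemidirectProduct.equivProd.symm
  have hfinB : Finite (P ⋊[ψ] L) := Finite.of_equiv _ SemidirectProduct.equivProd.symm
  have hpFact := Fact.mk hp
  have hqFact := Fact.mk hq
  have hcop : p.Coprime q := (Nat.coprime_primes hp hq).2 hpq
  have hQpow : ∀ r : Q, r ^ q = 1 := fun r => hQexp ▸ Monoid.pow_exponent_eq_one r
  have hPpow : ∀ r : P, r ^ p = 1 := fun r => hPexp ▸ Monoid.pow_exponent_eq_one r
  obtain ⟨c, hc⟩ := exists_prime_orderOf_dvd_card' (G := C) p (hCcard ▸ dvd_mul_right p q)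
  obtain ⟨d, hd⟩ := exists_prime_orderOf_dvd_card' (G := C) q (hCcard ▸ dvd_mul_left q p)
  have hcp : c ^ p = 1 := hc ▸ pow_orderOf_eq_one c
  have hdq : d ^ q = 1 := hd ▸ pow_orderOf_eq_one d
  have hc1 : c ≠ 1 := fun h => hp.one_lt.ne' (by rw [← hc, h, orderOf_one])
  have hd1 : d ≠ 1 := fun h => hq.one_lt.ne' (by rw [← hd, h, orderOf_one])
  have hbot : ∀ N : Subgroup (Amalgam α β), N.Normal → N ≠ ⊤ → ∀ i : Bool,
      N.comap (Monoid.PushoutI.of (φ := amalgamMap α β) i) = ⊥ := fun N hN hN1 =>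
    comap_of_eq_bot_of_ne_top (c := c) (d := d)
      (fun M hM hM1 => apply_mem_of_normal hq hQ hφ_triv hφ_faith hα hα_carter.2 hM hM1 hdq)
      (fun M hM hcM => eq_top_of_apply_mem hp hq hcop hQ hQpow hKcard hφ_triv hφ_faith hCcard
        hα hα_carter.2 hM hcp hc1 hcM)
      (fun M hM hM1 => apply_mem_of_normal hp hP hψ_triv hψ_faith hβ hβ_carter.2 hM hM1 hcp)
      (fun M hM hdM => eq_top_of_apply_mem hq hp hcop.symm hP hPpow hLcard hψ_triv hψ_faith
        (hCcard.trans (mul_comm p q)) hβ hβ_carter.2 hM hdq hd1 hdM)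
      hN hN1
  have hfree : ∀ N : Subgroup (Amalgam α β), N.Normal → N ≠ ⊤ → IsFreeGroup N :=
    fun N hN hN1 => Monoid.PushoutI.isFreeGroup_of_comap_of_eq_bot N
      (amalgamMap_injective hα hβ) (hbot N hN hN1)
  -- the commutator subgroup meets `A` nontrivially, because `Q` is not abelian
  have hperf : commutator (Amalgam α β) = ⊤ := by
    by_contra hne
    have h := hbot _ inferInstance hne false
    have hQtop : commutator Q = ⊥ := by
      rw [eq_bot_iff, commutator_def, Subgroup.commutator_le]
      intro r _ s _
      have h1 : amalgamInl α β (SemidirectProduct.inl ⁅r, s⁆) ∈ commutator (Amalgam α β) := by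
        rw [map_commutatorElement, map_commutatorElement]
        exact Subgroup.commutator_mem_commutator (Subgroup.mem_top _) (Subgroup.mem_top _)
      have h2 : (SemidirectProduct.inl ⁅r, s⁆ : Q ⋊[φ] K) = 1 := Subgroup.mem_bot.1 (h.le h1)
      rw [Subgroup.mem_bot]
      exact SemidirectProduct.inl_injective (h2.trans (map_one _).symm)
    have := hQ.card_center
    rw [← hQ.commutator_eq_center, hQtop, Subgroup.card_bot] at this
    exact hq.one_lt.ne this
  have hnt : Nontrivial (Q ⋊[φ] K) := ⟨α c, 1, fun h => hc1 (hα (h.trans (map_one α).symm))⟩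
  have hquot := exists_normal_finiteIndex_ne_top hα hβ
  refine ⟨fun N hN _ hN1 x hx hfin => ?_, hfree, hperf, ?_, ?_⟩
  · have := hfree N hN hN1
    have := IsFreeGroup.isMulTorsionFree N
    have hfin' : IsOfFinOrder (⟨x, hx⟩ : N) := Submonoid.isOfFinOrder_coe.1 hfin
    exact congrArg Subtype.val ((isOfFinOrder_iff_eq_one _).1 hfin')
  · obtain ⟨N, hN, hfin, hne⟩ := hquot
    exact ⟨N, hN, hfin, hfree N hN hne⟩
  · obtain ⟨N, hN, hfin, hsimple⟩ := exists_normal_isSimpleGroup_quotient hquot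
    refine ⟨N, hN, hfin, hsimple, fun hcomm => ?_⟩
    have hle : commutator (Amalgam α β) ≤ N := by
      rw [commutator_def, Subgroup.commutator_le]
      intro x _ y _
      rw [← QuotientGroup.eq_one_iff, ← QuotientGroup.mk'_apply, map_commutatorElement,
        commutatorElement_eq_one_iff_mul_comm]
      exact hcomm _ _
    exact QuotientGroup.nontrivial_iff.1 hsimple.toNontrivial (top_le_iff.1 (hperf ▸ hle))
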